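/- Let $M$ be a complete smooth Riemannian manifold (without boundary) of dimension $d$, with Riemannian distance $\mathrm{d}(\cdot,\cdot)$ and Levi-Civita connection $\nabla$. Let $U\subseteq M$ be open, let $V\subseteq M\times\mathbb{R}$ be open with $U\times[0,1]\subseteq V$, and let $f\in C^2(V,\mathbb{R})$. For $(x,\lambda)\in V$ let $\operatorname{grad} f(x,\lambda)\in T_xM$ be the Riemannian gradient of $f(\cdot,\lambda)$ at $x$, let $\operatorname{Hess} f(x,\lambda)\colon T_xM\to T_xM$, $\xi\mapsto\nabla_\xi \operatorname{grad} f(\cdot,\lambda)$, be the Riemannian Hessian of $f(\cdot,\lambda)$ at $x$, and let $\frac{\partial}{\partial\lambda}\operatorname{grad} f(x,\lambda)\in T_xM$ be the derivative of $\lambda\mapsto\operatorname{grad} f(x,\lambda)$ in the fixed vector space $T_xM$. Assume that there are $x_0\in U$ with $\operatorname{grad} f(x_0,0)=0$ and a constant $L>0$ such that $B(x_0,L)=\{x\in M : \mathrm{d}(x_0,x)<L\}\subseteq U$, and that for every $(z,\lambda)\in U\times[0,1]$ 1. $\operatorname{rank}\operatorname{Hess} f(z,\lambda)=d$, 2. $\bigl\|\operatorname{Hess}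 f(z,\lambda)^{-1}\bigl[\tfrac{\partial}{\partial\lambda}\operatorname{grad} f(z,\lambda)\bigr]\bigr\|_z<L$. Then there exist an open interval $J\supset[0,1]$ and a curve $x\in C^1(J,M)$ with $x(\lambda)\in U$ for all $\lambda\in[0,1]$ such that $$x(0)=x_0,\qquad \operatorname{grad} f(x(\lambda),\lambda)=0\quad\text{for all }\lambda\in[0,1],$$ and this curve satisfies the Riemannian Davidenko equation $$\operatorname{Hess} f(x(\lambda),\lambda)[\dot x(\lambda)]+\frac{\partial}{\partial\lambda}\operatorname{grad} f(x(\lambda),\lambda)=0\quad\text{for all }\lambda\in[0,1].$$ -/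

import Mathlib

open Bundle Set NormedSpace
open scoped Manifold ContDiff Topology

noncomputable section


namespace RiemannianContinuation

section Gradient

variable {E : Type*} [NormedAddCommGroup E] [NormedSpace ℝ E] [FiniteDimensional ℝ E]
  {H : Type*} [TopologicalSpace H] (I : ModelWithCorners ℝ E H)
  {M : Type*} [TopologicalSpace M] [ChartedSpace H M] [IsManifold I 1 M]
  [RiemannianBundle (fun (x : M) ↦ TangentSpace I x)]

theorem completeSpace_tangentSpace (x : M) : CompleteSpace (TangentSpace I x) :=
  haveI : FiniteDimensional ℝ (TangentSpace I x) := inferInstanceAs (FiniteDimensional ℝ E)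
  FiniteDimensional.complete ℝ (TangentSpace I x)

/-- The vector of `T_x M` that represents a linear form on `T_x M` for the Riemannian metric. -/
def sharp (x : M) (φ : TangentSpace I x →L[ℝ] ℝ) : TangentSpace I x :=
  haveI := completeSpace_tangentSpace I x
  (InnerProductSpace.toDual ℝ (TangentSpace I x)).symm φ

variable {I} in
theorem inner_sharp (x : M) (φ : TangentSpace I x →L[ℝ] ℝ) (v : TangentSpace I x) :
    inner ℝ (sharp I x φ) v = φ v :=
  haveI := completeSpace_tangentSpace I x
  InnerProductSpace.toDual_symm_apply

/-- The Riemannian gradient of `f(·, lam)` at `x`: the vector representing the differential. -/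
def grad (f : M × ℝ → ℝ) (x : M) (lam : ℝ) : TangentSpace I x :=
  sharp I x (mvfderiv I (fun y ↦ f (y, lam)) x)

/-- The partial derivative in the parameter of `lam ↦ grad f(x, lam)`, a curve in the fixed vector
space `T_x M`. -/
def partialGrad (f : M × ℝ → ℝ) (x : M) (lam : ℝ) : TangentSpace I x :=
  deriv (fun t ↦ grad I f x t) lam

end Gradient

section Connection

variable {E : Type*} [NormedAddCommGroup E] [NormedSpace ℝ E] [FiniteDimensional ℝ E]
  {H : Type*} [TopologicalSpace H] (I : ModelWithCorners ℝ E H)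
  {M : Type*} [TopologicalSpace M] [ChartedSpace H M] [IsManifold I 2 M]
  [RiemannianBundle (fun (x : M) ↦ TangentSpace I x)]
  [IsContMDiffRiemannianBundle I 1 E (fun (x : M) ↦ TangentSpace I x)]

/-- Half of the right-hand side of the Koszul formula: the number that `⟨∇_X Y, Z⟩` has to be
at `x`. -/
def koszul (X Y Z : Π x : M, TangentSpace I x) (x : M) : ℝ :=
  2⁻¹ * (mvfderiv I (fun y ↦ inner ℝ (Y y) (Z y)) x (X x)
    + mvfderiv I (fun y ↦ inner ℝ (X y) (Z y)) x (Y x)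
    - mvfderiv I (fun y ↦ inner ℝ (X y) (Y y)) x (Z x)
    + inner ℝ (VectorField.mlieBracket I X Y x) (Z x)
    - inner ℝ (VectorField.mlieBracket I X Z x) (Y x)
    - inner ℝ (VectorField.mlieBracket I Y Z x) (X x))

variable {I}

theorem mdifferentiableAt_inner {x : M} {X Y : Π x : M, TangentSpace I x}
    (hX : MDiffAt (T% X) x) (hY : MDiffAt (T% Y) x) :
    MDiffAt (fun y ↦ inner ℝ (X y) (Y y)) x :=
  MDifferentiableAt.inner_bundle (E := fun x : M ↦ TangentSpace I x) hX hY

theorem mvfderiv_inner_add_left {x : M} {X X' Y : Π x : M, TangentSpace I x}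
    (hX : MDiffAt (T% X) x) (hX' : MDiffAt (T% X') x) (hY : MDiffAt (T% Y) x) :
    mvfderiv I (fun y ↦ inner ℝ ((X + X') y) (Y y)) x
      = mvfderiv I (fun y ↦ inner ℝ (X y) (Y y)) x
        + mvfderiv I (fun y ↦ inner ℝ (X' y) (Y y)) x := by
  rw [← mvfderiv_fun_add (mdifferentiableAt_inner hX hY) (mdifferentiableAt_inner hX' hY)]
  simp only [Pi.add_apply, inner_add_left]

theorem mvfderiv_inner_smul_left {x : M} {f : M → ℝ} {X Y : Π x : M, TangentSpace I x}
    (hf : MDiffAt f x) (hX : MDiffAt (T% X) x) (hY : MDiffAt (T% Y) x) :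
    mvfderiv I (fun y ↦ inner ℝ ((f • X) y) (Y y)) x
      = f x • mvfderiv I (fun y ↦ inner ℝ (X y) (Y y)) x
        + inner ℝ (X x) (Y x) • mvfderiv I f x := by
  rw [← mvfderiv_fun_mul hf (mdifferentiableAt_inner hX hY)]
  simp only [Pi.smul_apply', real_inner_smul_left]

theorem mvfderiv_inner_add_right {x : M} {X X' Y : Π x : M, TangentSpace I x}
    (hX : MDiffAt (T% X) x) (hX' : MDiffAt (T% X') x) (hY : MDiffAt (T% Y) x) :
    mvfderiv I (fun y ↦ inner ℝ (Y y) ((X + X') y)) x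
      = mvfderiv I (fun y ↦ inner ℝ (Y y) (X y)) x
        + mvfderiv I (fun y ↦ inner ℝ (Y y) (X' y)) x := by
  simpa only [real_inner_comm] using mvfderiv_inner_add_left hX hX' hY

theorem mvfderiv_inner_smul_right {x : M} {f : M → ℝ} {X Y : Π x : M, TangentSpace I x}
    (hf : MDiffAt f x) (hX : MDiffAt (T% X) x) (hY : MDiffAt (T% Y) x) :
    mvfderiv I (fun y ↦ inner ℝ (Y y) ((f • X) y)) x
      = f x • mvfderiv I (fun y ↦ inner ℝ (Y y) (X y)) x
        + inner ℝ (Y x) (X x) • mvfderiv I f x := by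
  simpa only [real_inner_comm] using mvfderiv_inner_smul_left hf hX hY

theorem koszul_tensorial_left {x : M} {Y Z : Π x : M, TangentSpace I x}
    (hY : MDiffAt (T% Y) x) (hZ : MDiffAt (T% Z) x) :
    TensorialAt I E (fun X ↦ koszul I X Y Z x) x where
  smul {f X} hf hX := by
    simp only [koszul, mvfderiv_inner_smul_left hf hX hY, mvfderiv_inner_smul_left hf hX hZ,
      VectorField.mlieBracket_smul_left hf hX]
    simp [inner_add_left, real_inner_smul_left, real_inner_smul_right]
    ring
  add {X X'} hX hX' := by
    simp only [koszul, mvfderiv_inner_add_left hX hX' hY, mvfderiv_inner_add_left hX hX' hZ,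
      VectorField.mlieBracket_add_left hX hX']
    simp [inner_add_left, inner_add_right]
    ring

theorem koszul_tensorial_right {x : M} {X Y : Π x : M, TangentSpace I x}
    (hX : MDiffAt (T% X) x) (hY : MDiffAt (T% Y) x) :
    TensorialAt I E (fun Z ↦ koszul I X Y Z x) x where
  smul {f Z} hf hZ := by
    simp only [koszul, mvfderiv_inner_smul_right hf hZ hY, mvfderiv_inner_smul_right hf hZ hX,
      VectorField.mlieBracket_smul_right hf hZ]
    simp [inner_add_left, real_inner_smul_left, real_inner_smul_right]
    rw [real_inner_comm (X x) (Z x), real_inner_comm (Y x) (Z x)]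
    ring
  add {Z Z'} hZ hZ' := by
    simp only [koszul, mvfderiv_inner_add_right hZ hZ' hY, mvfderiv_inner_add_right hZ hZ' hX,
      VectorField.mlieBracket_add_right hZ hZ']
    simp [inner_add_left, inner_add_right]
    ring

theorem koszul_add_middle {x : M} {X Y Y' Z : Π x : M, TangentSpace I x}
    (hX : MDiffAt (T% X) x) (hY : MDiffAt (T% Y) x) (hY' : MDiffAt (T% Y') x)
    (hZ : MDiffAt (T% Z) x) :
    koszul I X (Y + Y') Z x = koszul I X Y Z x + koszul I X Y' Z x := by
  simp only [koszul, mvfderiv_inner_add_right hY hY' hX, mvfderiv_inner_add_left hY hY' hZ,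
    VectorField.mlieBracket_add_right hY hY', VectorField.mlieBracket_add_left hY hY']
  simp [inner_add_left, inner_add_right]
  ring

theorem koszul_smul_middle {x : M} {f : M → ℝ} {X Y Z : Π x : M, TangentSpace I x}
    (hf : MDiffAt f x) (hX : MDiffAt (T% X) x) (hY : MDiffAt (T% Y) x)
    (hZ : MDiffAt (T% Z) x) :
    koszul I X (f • Y) Z x
      = f x * koszul I X Y Z x + mvfderiv I f x (X x) * inner ℝ (Y x) (Z x) := by
  simp only [koszul, mvfderiv_inner_smul_right hf hY hX, mvfderiv_inner_smul_left hf hY hZ,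
    VectorField.mlieBracket_smul_right hf hY, VectorField.mlieBracket_smul_left hf hY]
  simp [inner_add_left, real_inner_smul_left, real_inner_smul_right]
  rw [real_inner_comm (X x) (Y x)]
  ring

/-- The Koszul form at `x` as a bilinear form in the direction `X` and the test vector `Z`. -/
def koszulHom (Y : Π x : M, TangentSpace I x) (x : M) (hY : MDiffAt (T% Y) x) :
    TangentSpace I x →L[ℝ] TangentSpace I x →L[ℝ] ℝ :=
  TensorialAt.mkHom₂ (fun X Z ↦ koszul I X Y Z x) x
    (fun _ hZ ↦ koszul_tensorial_left hY hZ) (fun _ hX ↦ koszul_tensorial_right hX hY)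

theorem koszulHom_apply {X Y Z : Π x : M, TangentSpace I x} {x : M} (hX : MDiffAt (T% X) x)
    (hY : MDiffAt (T% Y) x) (hZ : MDiffAt (T% Z) x) :
    koszulHom Y x hY (X x) (Z x) = koszul I X Y Z x :=
  TensorialAt.mkHom₂_apply _ _ hX hZ

open scoped Classical in
/-- `v ↦ ∇_v Y` at `x`: the vector whose inner products are given by the Koszul formula. -/
def leviCivitaFun (Y : Π x : M, TangentSpace I x) (x : M) :
    TangentSpace I x →L[ℝ] TangentSpace I x :=
  haveI : FiniteDimensional ℝ (TangentSpace I x) := inferInstanceAs (FiniteDimensional ℝ E)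
  if hY : MDiffAt (T% Y) x then
    LinearMap.toContinuousLinearMap
      { toFun := fun v ↦ sharp I x (koszulHom Y x hY v)
        map_add' := fun v w ↦ ext_inner_right ℝ fun z ↦ by
          simp [inner_sharp, inner_add_left]
        map_smul' := fun c v ↦ ext_inner_right ℝ fun z ↦ by
          simp [inner_sharp, real_inner_smul_left] }
  else 0

theorem inner_leviCivitaFun {X Y Z : Π x : M, TangentSpace I x} {x : M}
    (hX : MDiffAt (T% X) x) (hY : MDiffAt (T% Y) x) (hZ : MDiffAt (T% Z) x) :
    inner ℝ (leviCivitaFun Y x (X x)) (Z x) = koszul I X Y Z x := by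
  rw [leviCivitaFun, dif_pos hY, ← koszulHom_apply hX hY hZ]
  exact inner_sharp x _ _

theorem mdifferentiableAt_extend_tangent {x : M} (v : TangentSpace I x) :
    MDiffAt (T% (FiberBundle.extend E v)) x :=
  FiberBundle.mdifferentiableAt_extend I E v

theorem inner_leviCivitaFun_extend {Y : Π x : M, TangentSpace I x} {x : M}
    (hY : MDiffAt (T% Y) x) (v w : TangentSpace I x) :
    inner ℝ (leviCivitaFun Y x v) w
      = koszul I (FiberBundle.extend E v) Y (FiberBundle.extend E w) x := by
  rw [← inner_leviCivitaFun (mdifferentiableAt_extend_tangent v) hY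
    (mdifferentiableAt_extend_tangent w), FiberBundle.extend_apply_self,
    FiberBundle.extend_apply_self]

variable (I M) in
/-- The Riemannian (Levi-Civita) connection of `M`; `leviCivita I M Y x v` is `∇_v Y` at `x`. -/
def leviCivita : CovariantDerivative I E (fun x : M ↦ TangentSpace I x) where
  toFun := leviCivitaFun
  isCovariantDerivativeOnUniv :=
    { add := fun {Y Y' x} hY hY' _ ↦ by
        ext v
        refine ext_inner_right ℝ fun w ↦ ?_
        have hadd : MDiffAt (T% (Y + Y')) x := mdifferentiableAt_add_section hY hY'
        rw [add_apply, inner_add_left, inner_leviCivitaFun_extend hadd,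
          inner_leviCivitaFun_extend hY, inner_leviCivitaFun_extend hY']
        exact koszul_add_middle (mdifferentiableAt_extend_tangent v) hY hY'
          (mdifferentiableAt_extend_tangent w)
      leibniz := fun {Y f x} hY hf _ ↦ by
        ext v
        refine ext_inner_right ℝ fun w ↦ ?_
        have hsmul : MDiffAt (T% (f • Y)) x := hf.smul_section hY
        rw [inner_leviCivitaFun_extend hsmul, koszul_smul_middle hf
          (mdifferentiableAt_extend_tangent v) hY (mdifferentiableAt_extend_tangent w),
          ← inner_leviCivitaFun_extend hY]
        simp [inner_add_left, real_inner_smul_left] }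

/-- The Levi-Civita connection is torsion-free. -/
theorem leviCivita_torsion : (leviCivita I M).torsion = 0 := by
  rw [CovariantDerivative.torsion_eq_zero_iff]
  intro X Y x hX hY
  refine ext_inner_right ℝ fun w ↦ ?_
  have hw := mdifferentiableAt_extend_tangent w
  have h1 := inner_leviCivitaFun hX hY hw
  have h2 := inner_leviCivitaFun hY hX hw
  rw [FiberBundle.extend_apply_self] at h1 h2
  rw [inner_sub_left]
  refine (congrArg₂ (· - ·) h1 h2).trans ?_
  have hs : VectorField.mlieBracket I Y X x = - VectorField.mlieBracket I X Y x :=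
    VectorField.mlieBracket_swap_apply
  have hc : (fun y ↦ inner ℝ (Y y) (X y)) = fun y : M ↦ inner ℝ (X y) (Y y) :=
    funext fun y ↦ real_inner_comm _ _
  simp only [koszul, FiberBundle.extend_apply_self, hs, hc, inner_neg_left]
  ring

/-- The Levi-Civita connection is compatible with the metric:
`X⟨Y, Z⟩ = ⟨∇_X Y, Z⟩ + ⟨Y, ∇_X Z⟩`. -/
theorem leviCivita_metric {X Y Z : Π x : M, TangentSpace I x} {x : M}
    (hX : MDiffAt (T% X) x) (hY : MDiffAt (T% Y) x) (hZ : MDiffAt (T% Z) x) :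
    mvfderiv I (fun y ↦ inner ℝ (Y y) (Z y)) x (X x)
      = inner ℝ (leviCivita I M Y x (X x)) (Z x) + inner ℝ (Y x) (leviCivita I M Z x (X x)) := by
  have h1 : inner ℝ (leviCivita I M Y x (X x)) (Z x) = koszul I X Y Z x :=
    inner_leviCivitaFun hX hY hZ
  have h2 : inner ℝ (leviCivita I M Z x (X x)) (Y x) = koszul I X Z Y x :=
    inner_leviCivitaFun hX hZ hY
  have hs : VectorField.mlieBracket I Z Y x = - VectorField.mlieBracket I Y Z x :=
    VectorField.mlieBracket_swap_apply
  have hc : (fun y ↦ inner ℝ (Z y) (Y y)) = fun y : M ↦ inner ℝ (Y y) (Z y) :=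
    funext fun y ↦ real_inner_comm _ _
  rw [real_inner_comm (leviCivita I M Z x (X x)) (Y x), h1, h2]
  simp only [koszul, hs, hc, inner_neg_left]
  ring

variable (I)

/-- The Riemannian Hessian of `f(·, lam)` at `x`: `ξ ↦ ∇_ξ grad f(·, lam)`. -/
def hess (f : M × ℝ → ℝ) (x : M) (lam : ℝ) : TangentSpace I x →L[ℝ] TangentSpace I x :=
  leviCivita I M (fun y ↦ grad I f y lam) x

end Connection

end RiemannianContinuation

end

/-
At a critical point `z` of `f(·, s)` the Hessian, read in the chart at `z`, is the derivative of the
chart differential of `f(·, s)`: the Christoffel terms are multiplied by the gradient. The implicit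
function theorem therefore continues critical points uniquely in the parameter. Differentiating
`grad f (x(s), s) = 0` gives the Davidenko equation, so a curve of critical points has speed smaller
than `L`. If it is defined on `[0, T)` with `T ≤ 1`, it is Lipschitz and converges, by completeness,
to a point at distance smaller than `L` from `x₀`, which lies in `U` and is critical by continuity.
Continuing from there moves `T` further, and the continuation reaches the parameter `1`.
-/

noncomputable section

namespace RiemannianContinuation

section LinearAlgebra

open Module

theorem isInvertible_of_injective_of_finrank_eq {𝕜 E F : Type*} [NontriviallyNormedField 𝕜]
    [CompleteSpace 𝕜] [AddCommGroup E] [TopologicalSpace E] [IsTopologicalAddGroup E] [Module 𝕜 E]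
    [ContinuousSMul 𝕜 E] [T2Space E] [FiniteDimensional 𝕜 E] [AddCommGroup F] [TopologicalSpace F]
    [IsTopologicalAddGroup F] [Module 𝕜 F] [ContinuousSMul 𝕜 F] [T2Space F]
    [FiniteDimensional 𝕜 F] {A : E →L[𝕜] F} (hA : Function.Injective A)
    (h : finrank 𝕜 E = finrank 𝕜 F) : A.IsInvertible :=
  ⟨(LinearMap.linearEquivOfInjective (A : E →ₗ[𝕜] F) hA h).toContinuousLinearEquiv, rfl⟩

theorem isInvertible_of_injective_dual {𝕜 E : Type*} [NontriviallyNormedField 𝕜] [CompleteSpace 𝕜]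
    [NormedAddCommGroup E] [NormedSpace 𝕜 E] [FiniteDimensional 𝕜 E] {A : E →L[𝕜] E →L[𝕜] 𝕜}
    (hA : Function.Injective A) : A.IsInvertible := by
  refine isInvertible_of_injective_of_finrank_eq hA ?_
  rw [← (LinearMap.toContinuousLinearMap (𝕜 := 𝕜) (E := E) (F' := 𝕜)).finrank_eq]
  exact Subspace.dual_finrank_eq.symm

theorem isInvertible_of_finrank_range_eq {𝕜 E : Type*} [NontriviallyNormedField 𝕜] [CompleteSpace 𝕜]
    [AddCommGroup E] [TopologicalSpace E] [IsTopologicalAddGroup E] [Module 𝕜 E]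
    [ContinuousSMul 𝕜 E] [T2Space E] [FiniteDimensional 𝕜 E] {A : E →L[𝕜] E}
    (hA : finrank 𝕜 A.range = finrank 𝕜 E) : A.IsInvertible := by
  have hsurj : Function.Surjective (A : E →ₗ[𝕜] E) :=
    LinearMap.range_eq_top.1 (Submodule.eq_top_of_finrank_eq hA)
  exact isInvertible_of_injective_of_finrank_eq (LinearMap.injective_iff_surjective.2 hsurj) rfl

end LinearAlgebra

section UniqueContinuation

open Filter

/-- A notion `Q x s` of a curve `x : α → X` being a solution at the time `s` that is local in time
and open, implies continuity, and is such that two solutions at a time `s ∈ K` which agree at `s`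
agree near `s`. -/
structure HasUniqueContinuationOn {α X : Type*} [TopologicalSpace α] [TopologicalSpace X]
    (Q : (α → X) → α → Prop) (K : Set α) : Prop where
  congr {x y : α → X} {s : α} : Q x s → y =ᶠ[𝓝 s] x → Q y s
  eventually {x : α → X} {s : α} : Q x s → ∀ᶠ t in 𝓝 s, Q x t
  continuousAt {x : α → X} {s : α} : Q x s → ContinuousAt x s
  eventuallyEq {x y : α → X} {s : α} : s ∈ K → Q x s → Q y s → x s = y s → x =ᶠ[𝓝 s] y

namespace HasUniqueContinuationOn

variable {α X : Type*} [TopologicalSpace α] [TopologicalSpace X]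
  {Q : (α → X) → α → Prop} {K : Set α}

section LinearOrder

variable [LinearOrder α] [OrderTopology α] {a b s : α} {x γ : α → X}

theorem eventually_forall_uIcc (hQ : HasUniqueContinuationOn Q K) (hx : Q x s) :
    ∀ᶠ t in 𝓝 s, ∀ r ∈ uIcc s t, Q x r :=
  (tendsto_const_nhds.uIcc tendsto_id).eventually (hQ.eventually hx).smallSets

theorem exists_extension_Icc (hQ : HasUniqueContinuationOn Q K) (hab : a < b)
    (hx : ∀ s ∈ Ico a b, Q x s) (hγ : Q γ b) (h : x =ᶠ[𝓝[<] b] γ) :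
    ∃ y : α → X, y a = x a ∧ ∀ s ∈ Icc a b, Q y s := by
  refine ⟨fun t ↦ if t < b then x t else γ t, if_pos hab, fun s hs ↦ ?_⟩
  rcases hs.2.lt_or_eq with hsb | rfl
  · refine hQ.congr (hx s ⟨hs.1, hsb⟩) ?_
    filter_upwards [Iio_mem_nhds hsb] with t ht using if_pos ht
  · refine hQ.congr hγ ?_
    filter_upwards [eventually_nhdsWithin_iff.1 h] with t ht
    split_ifs with hts
    · exact ht hts
    · rfl

end LinearOrder

variable [ConditionallyCompleteLinearOrder α] [DenselyOrdered α] [OrderTopology α] [T2Space X]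
  {a b : α} {x y : α → X} {x₀ : X}

theorem eqOn_Icc (hQ : HasUniqueContinuationOn Q K) (hK : Ico a b ⊆ K)
    (hx : ∀ s ∈ Icc a b, Q x s) (hy : ∀ s ∈ Icc a b, Q y s) (h : x a = y a) :
    EqOn x y (Icc a b) := by
  have hcont : ContinuousOn (fun t ↦ (x t, y t)) (Icc a b) := fun t ht ↦
    ((hQ.continuousAt (hx t ht)).prodMk (hQ.continuousAt (hy t ht))).continuousWithinAt
  have hclosed : IsClosed ({s | x s = y s} ∩ Icc a b) := by
    rw [inter_comm]
    exact hcont.preimage_isClosed_of_isClosed isClosed_Icc isClosed_diagonal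
  refine hclosed.Icc_subset_of_forall_mem_nhdsWithin h fun t ht ↦ mem_nhdsWithin_of_mem_nhds ?_
  have htI := Ico_subset_Icc_self ht.2
  exact hQ.eventuallyEq (hK ht.2) (hx t htI) (hy t htI) ht.1

theorem exists_forall_Ico (hQ : HasUniqueContinuationOn Q K) (hK : Ico a b ⊆ K)
    (hab : a < b)
    (h : ∀ t ∈ Ico a b, ∃ x : α → X, x a = x₀ ∧ ∀ s ∈ Icc a t, Q x s) :
    ∃ x : α → X, x a = x₀ ∧ ∀ s ∈ Ico a b, Q x s := by
  have : Nonempty X := ⟨x₀⟩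
  choose! c hc₀ hc using h
  refine ⟨fun t ↦ c (max a t) t, by simpa using hc₀ a ⟨le_rfl, hab⟩, fun s hs ↦ ?_⟩
  have hcs : Q (c s) s := hc s hs s ⟨hs.1, le_rfl⟩
  refine hQ.congr hcs ?_
  have hbelow : ∀ᶠ t in 𝓝 s, t < a → s = a := by
    rcases hs.1.eq_or_lt with rfl | has
    · exact .of_forall fun _ _ ↦ rfl
    · filter_upwards [Ioi_mem_nhds has] with t ht hta using absurd hta ht.not_gt
  filter_upwards [hbelow, hQ.eventually_forall_uIcc hcs, Iio_mem_nhds hs.2] with t hta hst htb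
  rcases lt_or_ge t a with h | hat
  · rw [max_eq_left h.le, hta h]
  rw [max_eq_right hat]
  have hcst : ∀ r ∈ Icc a t, Q (c s) r := fun r hr ↦ (le_total r s).elim
    (fun hrs ↦ hc s hs r ⟨hr.1, hrs⟩) fun hsr ↦ hst r (Icc_subset_uIcc ⟨hsr, hr.2⟩)
  exact hQ.eqOn_Icc ((Ico_subset_Ico_right (le_of_lt htb)).trans hK) (hc t ⟨hat, htb⟩) hcst
    ((hc₀ t ⟨hat, htb⟩).trans (hc₀ s hs).symm) ⟨hat, le_rfl⟩

theorem exists_forall_Icc (hQ : HasUniqueContinuationOn Q (Icc a b)) (hab : a ≤ b)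
    (hstart : ∃ x, x a = x₀ ∧ Q x a)
    (hlimit : ∀ T ∈ Ioc a b, ∀ x : α → X, x a = x₀ → (∀ s ∈ Ico a T, Q x s) →
      ∃ γ, Q γ T ∧ x =ᶠ[𝓝[<] T] γ) :
    ∃ x : α → X, x a = x₀ ∧ ∀ s ∈ Icc a b, Q x s := by
  let S : Set α := {T | ∃ x : α → X, x a = x₀ ∧ ∀ s ∈ Icc a T, Q x s}
  have hstartS : a ∈ S := hstart.imp fun x hx ↦ ⟨hx.1, by simpa using hx.2⟩
  have hclosed : IsClosed (S ∩ Icc a b) := by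
    refine isClosed_of_closure_subset fun T hT ↦ ?_
    have hTI : T ∈ Icc a b := closure_minimal inter_subset_right isClosed_Icc hT
    refine ⟨?_, hTI⟩
    rcases hTI.1.eq_or_lt with rfl | haT
    · exact hstartS
    have hbelow : ∀ t ∈ Ico a T, t ∈ S := fun t ht ↦ by
      obtain ⟨T', htT', ⟨x, hxa, hx⟩, -⟩ := mem_closure_iff.1 hT (Ioi t) isOpen_Ioi ht.2
      exact ⟨x, hxa, fun s hs ↦ hx s ⟨hs.1, hs.2.trans htT'.le⟩⟩
    obtain ⟨x, hxa, hx⟩ := hQ.exists_forall_Ico (fun t ht ↦ ⟨ht.1, ht.2.le.trans hTI.2⟩) haT hbelow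
    obtain ⟨γ, hγ, hxγ⟩ := hlimit T ⟨haT, hTI.2⟩ x hxa hx
    obtain ⟨y, hya, hy⟩ := hQ.exists_extension_Icc haT hx hγ hxγ
    exact ⟨y, hya.trans hxa, hy⟩
  have hopen : ∀ T ∈ S ∩ Ico a b, (S ∩ Ioc T b).Nonempty := by
    rintro T ⟨⟨x, hxa, hx⟩, haT, hTb⟩
    have := nhdsGT_neBot_of_exists_gt ⟨b, hTb⟩
    obtain ⟨t, ht, htI⟩ := (((hQ.eventually_forall_uIcc (hx T ⟨haT, le_rfl⟩)).filter_mono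
      nhdsWithin_le_nhds).and (Ioc_mem_nhdsGT hTb)).exists
    exact ⟨t, ⟨x, hxa, fun s hs ↦ (le_total s T).elim (fun h ↦ hx s ⟨hs.1, h⟩)
      fun h ↦ ht s (Icc_subset_uIcc ⟨h, hs.2⟩)⟩, htI⟩
  exact hclosed.mem_of_ge_of_forall_exists_gt hstartS hab hopen

end HasUniqueContinuationOn

end UniqueContinuation

section EDist

open Filter

theorem exists_tendsto_nhdsLT_of_edist_lt {X : Type*} [PseudoEMetricSpace X] [CompleteSpace X]
    {x : ℝ → X} {a b L : ℝ} (hab : a < b)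
    (h : ∀ s ∈ Ico a b, ∀ t ∈ Ico a b, s < t → edist (x s) (x t) < ENNReal.ofReal (L * (t - s))) :
    ∃ z, Tendsto x (𝓝[<] b) (𝓝 z) ∧ edist (x a) z < ENNReal.ofReal (L * (b - a)) := by
  have hlip : LipschitzOnWith L.toNNReal x (Ico a b) := by
    intro s hs t ht
    wlog hst : s < t generalizing s t
    · rcases (not_lt.1 hst).eq_or_lt with rfl | hts
      · simp
      · simpa only [edist_comm] using this ht hs hts
    calc edist (x s) (x t) ≤ ENNReal.ofReal (L * (t - s)) := (h s hs t ht hst).le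
      _ = L.toNNReal * edist s t := by
        rw [ENNReal.ofReal_mul' (sub_nonneg.2 hst.le), edist_comm, edist_dist, Real.dist_eq,
          abs_of_pos (sub_pos.2 hst), ENNReal.ofReal]
  obtain ⟨z, hz⟩ : ∃ z, Tendsto x (𝓝[<] b) (𝓝 z) :=
    cauchy_map_iff_exists_tendsto.1 ((cauchy_nhds.mono nhdsWithin_le_nhds).map_of_le
      hlip.uniformContinuousOn (le_principal_iff.2 (Ico_mem_nhdsLT hab)))
  refine ⟨z, hz, ?_⟩
  -- The inequality remains strict in the limit because it is strict up to an intermediate time.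
  obtain ⟨m, ham, hmb⟩ := exists_between hab
  have hlt : edist (x a) (x m) < ENNReal.ofReal (L * (m - a)) :=
    h a ⟨le_rfl, hab⟩ m ⟨ham.le, hmb⟩ ham
  have hle : edist (x m) z ≤ ENNReal.ofReal (L * (b - m)) := by
    have hlim : Tendsto (fun t ↦ ENNReal.ofReal (L * (t - m))) (𝓝[<] b)
        (𝓝 (ENNReal.ofReal (L * (b - m)))) :=
      (ENNReal.continuous_ofReal.comp (by fun_prop : Continuous fun t ↦ L * (t - m))
        |>.tendsto b).mono_left nhdsWithin_le_nhds
    refine le_of_tendsto_of_tendsto (tendsto_const_nhds.edist hz) hlim ?_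
    filter_upwards [Ioo_mem_nhdsLT hmb] with t ht
    exact (h m ⟨ham.le, hmb⟩ t ⟨ham.le.trans ht.1.le, ht.2⟩ ht.1).le
  have hL : 0 < L := pos_of_mul_pos_left (ENNReal.ofReal_pos.1 (bot_le.trans_lt hlt))
    (sub_nonneg.2 ham.le)
  calc edist (x a) z ≤ edist (x a) (x m) + edist (x m) z := edist_triangle _ _ _
    _ < ENNReal.ofReal (L * (m - a)) + ENNReal.ofReal (L * (b - m)) :=
      ENNReal.add_lt_add_of_lt_of_le (hle.trans_lt ENNReal.ofReal_lt_top).ne hlt hle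
    _ = ENNReal.ofReal (L * (b - a)) := by
      rw [← ENNReal.ofReal_add (mul_nonneg hL.le (sub_nonneg.2 ham.le))
        (mul_nonneg hL.le (sub_nonneg.2 hmb.le))]
      ring_nf

open MeasureTheory in
theorem edist_lt_of_norm_mfderiv_lt {E : Type*} [NormedAddCommGroup E] [NormedSpace ℝ E]
    {H : Type*} [TopologicalSpace H] {I : ModelWithCorners ℝ E H}
    {M : Type*} [PseudoEMetricSpace M] [ChartedSpace H M]
    [RiemannianBundle (fun x : M ↦ TangentSpace I x)] [IsRiemannianManifold I M]
    {x : ℝ → M} {a b L : ℝ} (hab : a < b) (hx : ContMDiffOn 𝓘(ℝ, ℝ) I 1 x (Icc a b))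
    (hL : ∀ t ∈ Ioo a b, ‖mfderiv 𝓘(ℝ, ℝ) I x t (1 : ℝ)‖ < L) :
    edist (x a) (x b) < ENNReal.ofReal (L * (b - a)) := by
  have hspeed : ∀ t ∈ Ioo a b, ‖mfderiv 𝓘(ℝ, ℝ) I x t (1 : ℝ)‖ₑ < ENNReal.ofReal L := by
    intro t ht
    rw [← ofReal_norm]
    exact (ENNReal.ofReal_lt_ofReal_iff_of_nonneg (norm_nonneg _)).2 (hL t ht)
  have hconst : ∫⁻ _ in Ioo a b, ENNReal.ofReal L = ENNReal.ofReal (L * (b - a)) := by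
    rw [setLIntegral_const, Real.volume_Ioo, ENNReal.ofReal_mul' (sub_nonneg.2 hab.le)]
  have hfinite : ∫⁻ t in Ioo a b, ‖mfderiv 𝓘(ℝ, ℝ) I x t (1 : ℝ)‖ₑ ≠ ⊤ := by
    refine ((setLIntegral_mono measurable_const fun t ht ↦ (hspeed t ht).le).trans_lt ?_).ne
    exact hconst ▸ ENNReal.ofReal_lt_top
  calc edist (x a) (x b) = Manifold.riemannianEDist I (x a) (x b) := IsRiemannianManifold.out _ _
    _ ≤ ∫⁻ t in Ioo a b, ‖mfderiv 𝓘(ℝ, ℝ) I x t (1 : ℝ)‖ₑ :=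
      (Manifold.riemannianEDist_le_pathELength hx rfl rfl hab.le).trans_eq
        Manifold.pathELength_eq_lintegral_mfderiv_Ioo
    _ < ∫⁻ _ in Ioo a b, ENNReal.ofReal L :=
      setLIntegral_strict_mono measurableSet_Ioo (by simpa using hab) measurable_const hfinite
        (.of_forall hspeed)
    _ = ENNReal.ofReal (L * (b - a)) := hconst

end EDist

section Chart

variable {𝕜 : Type*} [NontriviallyNormedField 𝕜] {m n : ℕ∞ω}
  {E : Type*} [NormedAddCommGroup E] [NormedSpace 𝕜 E]
  {P : Type*} [NormedAddCommGroup P] [NormedSpace 𝕜 P]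
  {F : Type*} [NormedAddCommGroup F] [NormedSpace 𝕜 F]
  {H : Type*} [TopologicalSpace H] {I : ModelWithCorners 𝕜 E H}
  {M : Type*} [TopologicalSpace M] [ChartedSpace H M]
  {f : M × P → F} {g : M → F} {y z : M} {s : P}

section Tangent

variable [IsManifold I 1 M]

theorem continuousLinearMapAt_trivializationAt_self (v : TangentSpace I z) :
    (trivializationAt E (TangentSpace I) z).continuousLinearMapAt 𝕜 z v = v := by
  rw [TangentBundle.continuousLinearMapAt_trivializationAt (mem_chart_source H z),
    mfderiv_extChartAt_self]
  rfl

theorem continuousLinearMapAt_extend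
    (hy : y ∈ (trivializationAt E (TangentSpace I) z).baseSet) (v : TangentSpace I z) :
    (trivializationAt E (TangentSpace I) z).continuousLinearMapAt 𝕜 y
      (FiberBundle.extend E v y) = v := by
  rw [FiberBundle.extend, ← Trivialization.symmL_apply (R := 𝕜) _ hy,
    Trivialization.continuousLinearMapAt_symmL _ hy,
    ← Trivialization.continuousLinearMapAt_apply_of_mem (R := 𝕜) _
      (FiberBundle.mem_baseSet_trivializationAt' z), continuousLinearMapAt_trivializationAt_self]

theorem mvfderiv_comp_extChartAt_apply {h : E → F} (hh : DifferentiableAt 𝕜 h (extChartAt I z z))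
    (v : TangentSpace I z) :
    mvfderiv I (fun y ↦ h (extChartAt I z y)) z v = fderiv 𝕜 h (extChartAt I z z) v := by
  refine (mfderiv_comp_apply z hh.mdifferentiableAt
    (mdifferentiableAt_extChartAt (mem_chart_source H z)) v).trans ?_
  rw [mfderiv_extChartAt_self]
  exact congrArg (fun A : E →L[𝕜] F ↦ A v) mfderiv_eq_fderiv

end Tangent

theorem hasDerivAt_extChartAt_comp {x : 𝕜 → M} {t : 𝕜} (hx : MDiffAt x t) :
    HasDerivAt (fun r ↦ extChartAt I (x t) (x r)) (mfderiv 𝓘(𝕜, 𝕜) I x t (1 : 𝕜) : E) t := by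
  let A : 𝕜 →L[𝕜] E := mfderiv 𝓘(𝕜, 𝕜) I x t
  have h : HasFDerivWithinAt (fun r ↦ extChartAt I (x t) (x r)) A (range 𝓘(𝕜, 𝕜)) t :=
    hx.hasMFDerivAt.2
  rw [modelWithCornersSelf_coe, range_id, hasFDerivWithinAt_univ] at h
  exact h.hasDerivAt

theorem eventually_mdifferentiableAt_slice [IsManifold I 1 M]
    (hf : ContMDiffAt (I.prod 𝓘(𝕜, P)) 𝓘(𝕜, F) 1 f (z, s)) :
    ∀ᶠ p : M × P in 𝓝 (z, s), MDiffAt (fun x ↦ f (x, p.2)) p.1 := by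
  filter_upwards [(contMDiffAt_iff_contMDiffAt_nhds (by decide)).1 hf] with p hp
  exact (hp.comp p.1 (contMDiffAt_id.prodMk contMDiffAt_const)).mdifferentiableAt one_ne_zero

theorem continuousAt_prodMk_extChartAt {P : Type*} [TopologicalSpace P] {s : P} :
    ContinuousAt (fun p : M × P ↦ (p.2, extChartAt I z p.1)) (z, s) :=
  continuousAt_snd.prodMk
    ((continuousAt_extChartAt z).comp (f := Prod.fst) (x := (z, s)) continuousAt_fst)

variable (I) in
/-- The derivative in the space variable of `f : M × P → F`, read in the chart at `z`, as a
function of the parameter and of the chart coordinate, in this order. -/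
def chartFDeriv (f : M × P → F) (z : M) (p : P × E) : E →L[𝕜] F :=
  fderiv 𝕜 (fun u ↦ f ((extChartAt I z).symm u, p.1)) p.2

variable [I.Boundaryless]

theorem contDiffAt_comp_extChartAt_symm [IsManifold I n M]
    (hf : ContMDiffAt (I.prod 𝓘(𝕜, P)) 𝓘(𝕜, F) n f (y, s))
    (hy : y ∈ (extChartAt I z).source) :
    ContDiffAt 𝕜 n (fun p : P × E ↦ f ((extChartAt I z).symm p.2, p.1))
      (s, extChartAt I z y) := by
  have hsymm : ContMDiffAt 𝓘(𝕜, E) I n (extChartAt I z).symm (extChartAt I z y) :=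
    (contMDiffOn_extChartAt_symm z).contMDiffAt
      (extChartAt_target_mem_nhds' ((extChartAt I z).map_source hy))
  have hpair : ContMDiffAt 𝓘(𝕜, P × E) (I.prod 𝓘(𝕜, P)) n
      (fun p : P × E ↦ ((extChartAt I z).symm p.2, p.1)) (s, extChartAt I z y) :=
    (hsymm.comp (s, extChartAt I z y) contDiffAt_snd.contMDiffAt).prodMk
      contDiffAt_fst.contMDiffAt
  exact (hf.comp_of_eq hpair (congrArg (·, s) ((extChartAt I z).left_inv hy))).contDiffAt

theorem contDiffAt_chartFDeriv [IsManifold I n M]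
    (hf : ContMDiffAt (I.prod 𝓘(𝕜, P)) 𝓘(𝕜, F) n f (y, s))
    (hy : y ∈ (extChartAt I z).source) (hmn : m + 1 ≤ n) :
    ContDiffAt 𝕜 m (chartFDeriv I f z) (s, extChartAt I z y) := by
  refine ContDiffAt.fderiv (f := fun (p : P × E) (u : E) ↦ f ((extChartAt I z).symm u, p.1))
    (g := Prod.snd) ?_ contDiffAt_snd hmn
  exact (contDiffAt_comp_extChartAt_symm hf hy).comp
    (f := fun q : (P × E) × E ↦ (q.1.1, q.2)) ((s, extChartAt I z y), extChartAt I z y)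
    (by fun_prop)

theorem mvfderiv_eq_fderiv_comp [IsManifold I 1 M] (hg : MDiffAt g y)
    (hy : y ∈ (extChartAt I z).source) :
    mvfderiv I g y = fderiv 𝕜 (g ∘ (extChartAt I z).symm) (extChartAt I z y) ∘L
      (trivializationAt E (TangentSpace I) z).continuousLinearMapAt 𝕜 y := by
  have hsource : y ∈ (chartAt H z).source := by rwa [extChartAt_source] at hy
  have hsymm : MDifferentiableAt 𝓘(𝕜, E) I (extChartAt I z).symm (extChartAt I z y) :=
    ((contMDiffOn_extChartAt_symm z).contMDiffAt
      (extChartAt_target_mem_nhds' ((extChartAt I z).map_source hy))).mdifferentiableAt one_ne_zero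
  have hread : MDifferentiableAt 𝓘(𝕜, E) 𝓘(𝕜, F) (g ∘ (extChartAt I z).symm)
      (extChartAt I z y) := hg.comp_of_eq _ hsymm ((extChartAt I z).left_inv hy)
  have heq : g =ᶠ[𝓝 y] (g ∘ (extChartAt I z).symm) ∘ extChartAt I z := by
    filter_upwards [(isOpen_extChartAt_source z).mem_nhds hy] with x hx
    exact congrArg g ((extChartAt I z).left_inv hx).symm
  rw [TangentBundle.continuousLinearMapAt_trivializationAt hsource, ← mfderiv_eq_fderiv]
  exact heq.mfderiv_eq.trans (mfderiv_comp y hread (mdifferentiableAt_extChartAt hsource))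

end Chart

section ImplicitFunction

variable {𝕜 : Type*} [RCLike 𝕜] {n : ℕ∞ω}
  {E : Type*} [NormedAddCommGroup E] [NormedSpace 𝕜 E] [CompleteSpace E]
  {P : Type*} [NormedAddCommGroup P] [NormedSpace 𝕜 P] [CompleteSpace P]
  {F : Type*} [NormedAddCommGroup F] [NormedSpace 𝕜 F] [CompleteSpace F]
  {H : Type*} [TopologicalSpace H] {I : ModelWithCorners 𝕜 E H} [I.Boundaryless]
  {M : Type*} [TopologicalSpace M] [ChartedSpace H M] [IsManifold I n M]

theorem exists_contMDiffAt_eventually_apply_extChartAt_eq_iff {G : P × E → F} {z : M} {s : P}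
    (hG : ContDiffAt 𝕜 n G (s, extChartAt I z z)) (hn : n ≠ 0)
    (hinv : (fderiv 𝕜 G (s, extChartAt I z z) ∘L .inr 𝕜 P E).IsInvertible) :
    ∃ γ : P → M, γ s = z ∧ ContMDiffAt 𝓘(𝕜, P) I n γ s ∧
      ∀ᶠ p : M × P in 𝓝 (z, s),
        G (p.2, extChartAt I z p.1) = G (s, extChartAt I z z) ↔ p.1 = γ p.2 := by
  let ψ : P → E := hG.implicitFunction hn hinv
  have hψs : ψ s = extChartAt I z z := hG.implicitFunction_apply_self hn hinv
  have hψ : ContDiffAt 𝕜 n ψ s := hG.contDiffAt_implicitFunction hn hinv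
  have htarget : (extChartAt I z).target ∈ 𝓝 (ψ s) := hψs ▸ extChartAt_target_mem_nhds z
  refine ⟨(extChartAt I z).symm ∘ ψ, ?_, ?_, ?_⟩
  · rw [Function.comp_apply, hψs, extChartAt_to_inv]
  · exact ((contMDiffOn_extChartAt_symm z).contMDiffAt htarget).comp s hψ.contMDiffAt
  filter_upwards [continuousAt_prodMk_extChartAt.eventually
      (hG.eventually_apply_eq_iff_implicitFunction hn hinv),
    continuousAt_fst.eventually (extChartAt_source_mem_nhds (I := I) z),
    continuousAt_snd.eventually (hψ.continuousAt.eventually htarget)] with p hp hsource hptarget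
  rw [hp, Function.comp_apply, PartialEquiv.eq_symm_apply _ hsource hptarget, eq_comm]

end ImplicitFunction

section RiemannianBundle

variable {EB : Type*} [NormedAddCommGroup EB] [NormedSpace ℝ EB]
  {HB : Type*} [TopologicalSpace HB] {IB : ModelWithCorners ℝ EB HB} {n : ℕ∞ω}
  {B : Type*} [TopologicalSpace B] [ChartedSpace HB B]
  {F : Type*} [NormedAddCommGroup F] [NormedSpace ℝ F]
  {E : B → Type*} [TopologicalSpace (TotalSpace F E)] [∀ x, NormedAddCommGroup (E x)]
  [∀ x, InnerProductSpace ℝ (E x)] [FiberBundle F E] [VectorBundle ℝ F E] {y z : B}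

variable (F E) in
/-- The metric of a Riemannian vector bundle at `y`, read on the model fiber in the trivialization
at `z`. -/
def localMetric (z y : B) : F →L[ℝ] F →L[ℝ] ℝ :=
  (innerSL ℝ (E := E y)).bilinearComp ((trivializationAt F E z).symmL ℝ y)
    ((trivializationAt F E z).symmL ℝ y)

theorem localMetric_apply (z y : B) (v w : F) :
    localMetric F E z y v w = inner ℝ ((trivializationAt F E z).symmL ℝ y v)
      ((trivializationAt F E z).symmL ℝ y w) := rfl

theorem isInvertible_localMetric [FiniteDimensional ℝ F]
    (hy : y ∈ (trivializationAt F E z).baseSet) : (localMetric F E z y).IsInvertible := by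
  refine isInvertible_of_injective_dual ((injective_iff_map_eq_zero _).2 fun v hv ↦ ?_)
  have h : localMetric F E z y v v = 0 := by rw [hv, zero_apply]
  rw [localMetric_apply, inner_self_eq_zero] at h
  rw [← Trivialization.continuousLinearMapAt_symmL (R := ℝ) _ hy v, h, map_zero]

theorem contMDiffAt_localMetric [IsContMDiffRiemannianBundle IB n F E] :
    ContMDiffAt IB 𝓘(ℝ, F →L[ℝ] F →L[ℝ] ℝ) n (localMetric F E z) z := by
  obtain ⟨g, hg, hinner⟩ := IsContMDiffRiemannianBundle.exists_contMDiff (IB := IB) (n := n)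
    (F := F) (E := E)
  refine ((contMDiffAt_section z).1 (hg z)).congr_of_eventuallyEq ?_
  filter_upwards [(trivializationAt F E z).open_baseSet.mem_nhds
    (FiberBundle.mem_baseSet_trivializationAt' z)] with y hy
  ext v w
  rw [localMetric_apply, hinner, hom_trivializationAt_apply,
    inCoordinates_apply_eq₂ hy hy (by simp)]
  simp [Trivialization.symmL_apply _ hy]

theorem contMDiffAt_section_of_inner_eq [FiniteDimensional ℝ F]
    [IsContMDiffRiemannianBundle IB n F E] {X : Π y, E y} {φ : B → F →L[ℝ] ℝ}
    (hφ : ContMDiffAt IB 𝓘(ℝ, F →L[ℝ] ℝ) n φ z)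
    (h : ∀ᶠ y in 𝓝 z, ∀ v, inner ℝ (X y) ((trivializationAt F E z).symmL ℝ y v) = φ y v) :
    ContMDiffAt IB (IB.prod 𝓘(ℝ, F)) n (T% X) z := by
  set e := trivializationAt F E z
  have hz : z ∈ e.baseSet := FiberBundle.mem_baseSet_trivializationAt' z
  have hinv : ContMDiffAt IB 𝓘(ℝ, (F →L[ℝ] ℝ) →L[ℝ] F) n
      (fun y ↦ (localMetric F E z y).inverse) z :=
    (isInvertible_localMetric hz).contDiffAt_map_inverse.contMDiffAt.comp z contMDiffAt_localMetric
  rw [contMDiffAt_section]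
  refine (hinv.clm_apply hφ).congr_of_eventuallyEq ?_
  filter_upwards [e.open_baseSet.mem_nhds hz, h] with y hy hXy
  symm
  rw [(isInvertible_localMetric hy).inverse_apply_eq,
    ← e.continuousLinearMapAt_apply_of_mem (R := ℝ) hy]
  ext v
  rw [localMetric_apply, e.symmL_continuousLinearMapAt hy, hXy]

end RiemannianBundle

section Gradient

variable {E : Type*} [NormedAddCommGroup E] [NormedSpace ℝ E] [FiniteDimensional ℝ E]
  {H : Type*} [TopologicalSpace H] {I : ModelWithCorners ℝ E H}
  {M : Type*} [TopologicalSpace M] [ChartedSpace H M] [IsManifold I 1 M]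
  [RiemannianBundle (fun x : M ↦ TangentSpace I x)]
  {f : M × ℝ → ℝ} {y z : M} {s : ℝ}

theorem sharp_add (φ ψ : TangentSpace I z →L[ℝ] ℝ) :
    sharp I z (φ + ψ) = sharp I z φ + sharp I z ψ :=
  ext_inner_right ℝ fun v ↦ by simp only [inner_add_left, inner_sharp, add_apply]

theorem sharp_smul (c : ℝ) (φ : TangentSpace I z →L[ℝ] ℝ) : sharp I z (c • φ) = c • sharp I z φ :=
  ext_inner_right ℝ fun v ↦ by
    simp only [real_inner_smul_left, inner_sharp, smul_apply, smul_eq_mul]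

theorem hasDerivAt_sharp {φ : ℝ → E →L[ℝ] ℝ} {φ' : E →L[ℝ] ℝ} (hφ : HasDerivAt φ φ' s) :
    HasDerivAt (fun t ↦ sharp I z (φ t)) (sharp I z φ') s := by
  let A : (E →L[ℝ] ℝ) →ₗ[ℝ] TangentSpace I z :=
    { toFun := fun φ ↦ sharp I z φ
      map_add' := sharp_add
      map_smul' := sharp_smul }
  exact (LinearMap.toContinuousLinearMap A).hasFDerivAt.comp_hasDerivAt s hφ

variable [I.Boundaryless]

theorem inner_grad (hf : MDiffAt (fun x ↦ f (x, s)) y) (hy : y ∈ (extChartAt I z).source)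
    (v : TangentSpace I y) :
    inner ℝ (grad I f y s) v = chartFDeriv I f z (s, extChartAt I z y)
      ((trivializationAt E (TangentSpace I) z).continuousLinearMapAt ℝ y v) := by
  rw [grad, inner_sharp, mvfderiv_eq_fderiv_comp hf hy]
  rfl

theorem grad_eq_sharp_chartFDeriv (hf : MDiffAt (fun x ↦ f (x, s)) z) :
    grad I f z s = sharp I z (chartFDeriv I f z (s, extChartAt I z z) : E →L[ℝ] ℝ) :=
  ext_inner_right ℝ fun v ↦ (inner_grad hf (mem_extChartAt_source z) v).trans
    ((congrArg _ (continuousLinearMapAt_trivializationAt_self v)).trans (inner_sharp z _ v).symm)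

theorem grad_eq_zero_iff (hf : MDiffAt (fun x ↦ f (x, s)) y) (hy : y ∈ (extChartAt I z).source) :
    grad I f y s = 0 ↔ chartFDeriv I f z (s, extChartAt I z y) = 0 := by
  have hbase : y ∈ (trivializationAt E (TangentSpace I) z).baseSet := by simpa using hy
  constructor <;> intro h
  · ext v
    have hv := inner_grad hf hy ((trivializationAt E (TangentSpace I) z).symmL ℝ y v)
    rw [h, inner_zero_left, Trivialization.continuousLinearMapAt_symmL _ hbase] at hv
    exact hv.symm
  · refine ext_inner_right ℝ fun v ↦ ?_
    rw [inner_grad hf hy, h, inner_zero_left, zero_apply]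

theorem eventually_grad_eq_zero_iff
    (hf : ContMDiffAt (I.prod 𝓘(ℝ, ℝ)) 𝓘(ℝ, ℝ) 1 f (z, s)) :
    ∀ᶠ p : M × ℝ in 𝓝 (z, s), grad I f p.1 p.2 = 0 ↔
      chartFDeriv I f z (p.2, extChartAt I z p.1) = 0 := by
  filter_upwards [continuousAt_fst.eventually (extChartAt_source_mem_nhds (I := I) z),
    eventually_mdifferentiableAt_slice hf] with p hp hfp
  exact grad_eq_zero_iff hfp hp

theorem grad_eq_zero_of_frequently (hf : ContMDiffAt (I.prod 𝓘(ℝ, ℝ)) 𝓘(ℝ, ℝ) 1 f (z, s))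
    (h : ∃ᶠ p : M × ℝ in 𝓝 (z, s), grad I f p.1 p.2 = 0) : grad I f z s = 0 := by
  have hiff := eventually_grad_eq_zero_iff hf
  have hchart : ContinuousAt (fun p : M × ℝ ↦ chartFDeriv I f z (p.2, extChartAt I z p.1)) (z, s) :=
    (contDiffAt_chartFDeriv (m := 0) hf (mem_extChartAt_source z) le_rfl).continuousAt.comp_of_eq
      continuousAt_prodMk_extChartAt rfl
  rw [hiff.self_of_nhds]
  exact isClosed_singleton.mem_of_frequently_of_tendsto
    ((h.and_eventually hiff).mono fun p hp ↦ hp.2.1 hp.1) hchart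

theorem contMDiffAt_grad {m n : ℕ∞ω} [IsManifold I n M]
    [IsContMDiffRiemannianBundle I m E (fun x : M ↦ TangentSpace I x)]
    (hf : ContMDiffAt (I.prod 𝓘(ℝ, ℝ)) 𝓘(ℝ, ℝ) n f (z, s)) (hmn : m + 1 ≤ n) :
    ContMDiffAt I (I.prod 𝓘(ℝ, E)) m (T% (fun y ↦ grad I f y s)) z := by
  have hchart : ContMDiffAt I 𝓘(ℝ, E →L[ℝ] ℝ) m
      (fun y ↦ chartFDeriv I f z (s, extChartAt I z y)) z :=
    (contDiffAt_chartFDeriv hf (mem_extChartAt_source z) hmn).contMDiffAt.comp z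
      (contMDiffAt_const.prodMk_space
        ((contMDiffAt_extChartAt (n := n)).of_le (le_self_add.trans hmn)))
  refine contMDiffAt_section_of_inner_eq (E := fun x : M ↦ TangentSpace I x) hchart ?_
  filter_upwards [extChartAt_source_mem_nhds (I := I) z,
    (by fun_prop : ContinuousAt (fun y : M ↦ (y, s)) z).eventually
      (eventually_mdifferentiableAt_slice (hf.of_le (le_add_self.trans hmn)))] with y hy hfy v
  rw [inner_grad hfy hy, Trivialization.continuousLinearMapAt_symmL _ (by simpa using hy)]

end Gradient

section Hessian

variable {E : Type*} [NormedAddCommGroup E] [NormedSpace ℝ E] [FiniteDimensional ℝ E]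
  {H : Type*} [TopologicalSpace H] {I : ModelWithCorners ℝ E H} [I.Boundaryless]
  {M : Type*} [TopologicalSpace M] [ChartedSpace H M] [IsManifold I 2 M]
  [RiemannianBundle (fun x : M ↦ TangentSpace I x)]
  {f : M × ℝ → ℝ} {z : M} {s : ℝ}

theorem inner_partialGrad (hf : ContMDiffAt (I.prod 𝓘(ℝ, ℝ)) 𝓘(ℝ, ℝ) 2 f (z, s))
    (w : TangentSpace I z) :
    inner ℝ (partialGrad I f z s) w
      = fderiv ℝ (chartFDeriv I f z) (s, extChartAt I z z) ((1, 0) : ℝ × E) w := by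
  have hchart : HasDerivAt (fun t : ℝ ↦ chartFDeriv I f z (t, extChartAt I z z))
      (fderiv ℝ (chartFDeriv I f z) (s, extChartAt I z z) ((1, 0) : ℝ × E)) s :=
    HasFDerivAt.comp_hasDerivAt (f := fun t : ℝ ↦ (t, extChartAt I z z)) s
      ((contDiffAt_chartFDeriv hf (mem_extChartAt_source z) one_add_one_eq_two.le).differentiableAt
        one_ne_zero).hasFDerivAt ((hasDerivAt_id s).prodMk (hasDerivAt_const s _))
  have hgrad : (fun t ↦ grad I f z t) =ᶠ[𝓝 s]
      fun t ↦ sharp I z (chartFDeriv I f z (t, extChartAt I z z) : E →L[ℝ] ℝ) := by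
    filter_upwards [(by fun_prop : ContinuousAt (fun t : ℝ ↦ (z, t)) s).eventually
      (eventually_mdifferentiableAt_slice (hf.of_le one_le_two))] with t ht
    exact grad_eq_sharp_chartFDeriv ht
  have hderiv : partialGrad I f z s = sharp I z
      (fderiv ℝ (chartFDeriv I f z) (s, extChartAt I z z) ((1, 0) : ℝ × E) : E →L[ℝ] ℝ) :=
    (HasDerivAt.congr_of_eventuallyEq (F := TangentSpace I z) (hasDerivAt_sharp hchart) hgrad).deriv
  exact (congrArg (fun u ↦ inner ℝ u w) hderiv).trans (inner_sharp z _ w)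

variable [IsContMDiffRiemannianBundle I 1 E (fun x : M ↦ TangentSpace I x)]

theorem inner_hess_of_grad_eq_zero (hf : ContMDiffAt (I.prod 𝓘(ℝ, ℝ)) 𝓘(ℝ, ℝ) 2 f (z, s))
    (hz : grad I f z s = 0) (v w : TangentSpace I z) :
    inner ℝ (hess I f z s v) w
      = fderiv ℝ (chartFDeriv I f z) (s, extChartAt I z z) ((0, v) : ℝ × E) w := by
  let h : E → ℝ := fun u ↦ chartFDeriv I f z (s, u) w
  have hchart : DifferentiableAt ℝ (chartFDeriv I f z) (s, extChartAt I z z) :=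
    (contDiffAt_chartFDeriv hf (mem_extChartAt_source z)
      one_add_one_eq_two.le).differentiableAt one_ne_zero
  let evalAt : (E →L[ℝ] ℝ) →L[ℝ] ℝ := ContinuousLinearMap.apply ℝ ℝ w
  have hh : HasFDerivAt h (evalAt ∘L
      fderiv ℝ (chartFDeriv I f z) (s, extChartAt I z z) ∘L .inr ℝ ℝ E) (extChartAt I z z) :=
    evalAt.hasFDerivAt.comp (extChartAt I z z)
      (hchart.hasFDerivAt.comp (extChartAt I z z) (hasFDerivAt_prodMk_right s _))
  have heq : (fun y ↦ inner ℝ (grad I f y s) (FiberBundle.extend E w y))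
      =ᶠ[𝓝 z] fun y ↦ h (extChartAt I z y) := by
    filter_upwards [extChartAt_source_mem_nhds (I := I) z,
      (by fun_prop : ContinuousAt (fun y : M ↦ (y, s)) z).eventually
        (eventually_mdifferentiableAt_slice (hf.of_le one_le_two))] with y hy hfy
    rw [inner_grad hfy hy, continuousLinearMapAt_extend (by simpa using hy)]
  have hmetric := leviCivita_metric (mdifferentiableAt_extend_tangent v)
    ((contMDiffAt_grad hf one_add_one_eq_two.le).mdifferentiableAt one_ne_zero)
    (mdifferentiableAt_extend_tangent w)
  rw [hz, inner_zero_left, add_zero, FiberBundle.extend_apply_self,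
    FiberBundle.extend_apply_self] at hmetric
  rw [hess, ← hmetric]
  calc mvfderiv I (fun y ↦ inner ℝ (grad I f y s) (FiberBundle.extend E w y)) z v
    _ = mvfderiv I (fun y ↦ h (extChartAt I z y)) z v :=
      congrArg (fun A : E →L[ℝ] ℝ ↦ A v) heq.mfderiv_eq
    _ = fderiv ℝ h (extChartAt I z z) v := mvfderiv_comp_extChartAt_apply hh.differentiableAt v
    _ = fderiv ℝ (chartFDeriv I f z) (s, extChartAt I z z) ((0, v) : ℝ × E) w := by
      rw [hh.fderiv]; rfl

theorem inner_hess_add_partialGrad (hf : ContMDiffAt (I.prod 𝓘(ℝ, ℝ)) 𝓘(ℝ, ℝ) 2 f (z, s))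
    (hz : grad I f z s = 0) (v w : TangentSpace I z) :
    inner ℝ (hess I f z s v + partialGrad I f z s) w
      = fderiv ℝ (chartFDeriv I f z) (s, extChartAt I z z) ((1, v) : ℝ × E) w := by
  let A : ℝ × E →L[ℝ] E →L[ℝ] ℝ := fderiv ℝ (chartFDeriv I f z) (s, extChartAt I z z)
  have hA (u : E) : A (0, u) + A (1, 0) = A (1, u) := by rw [← map_add]; simp
  calc inner ℝ (hess I f z s v + partialGrad I f z s) w
    _ = inner ℝ (hess I f z s v) w + inner ℝ (partialGrad I f z s) w := inner_add_left _ _ _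
    _ = A (0, v) w + A (1, 0) w :=
      congrArg₂ (· + ·) (inner_hess_of_grad_eq_zero hf hz v w) (inner_partialGrad hf w)
    _ = A (1, v) w := congrArg (fun B : E →L[ℝ] ℝ ↦ B w) (hA v)

theorem hess_mfderiv_add_partialGrad_eq_zero {x : ℝ → M} (hx : MDiffAt x s)
    (hf : ContMDiffAt (I.prod 𝓘(ℝ, ℝ)) 𝓘(ℝ, ℝ) 2 f (x s, s))
    (hcrit : ∀ᶠ t in 𝓝 s, grad I f (x t) t = 0) :
    hess I f (x s) s (mfderiv 𝓘(ℝ, ℝ) I x s (1 : ℝ)) + partialGrad I f (x s) s = 0 := by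
  have hcurve : HasDerivAt (fun t ↦ (t, extChartAt I (x s) (x t)))
      ((1, mfderiv 𝓘(ℝ, ℝ) I x s (1 : ℝ)) : ℝ × E) s :=
    (hasDerivAt_id s).prodMk (hasDerivAt_extChartAt_comp hx)
  have hderiv := HasFDerivAt.comp_hasDerivAt (f := fun t ↦ (t, extChartAt I (x s) (x t))) s
    ((contDiffAt_chartFDeriv hf (mem_extChartAt_source (x s))
      one_add_one_eq_two.le).differentiableAt one_ne_zero).hasFDerivAt hcurve
  have hzero : (chartFDeriv I f (x s) ∘ fun t ↦ (t, extChartAt I (x s) (x t))) =ᶠ[𝓝 s]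
      fun _ ↦ 0 := by
    filter_upwards [hcrit, (hx.continuousAt.prodMk continuousAt_id).eventually
      (eventually_grad_eq_zero_iff (hf.of_le one_le_two))] with t ht hiff
    exact hiff.1 ht
  refine ext_inner_right ℝ fun w ↦ ?_
  rw [inner_hess_add_partialGrad hf hcrit.self_of_nhds, inner_zero_left]
  exact congrArg (fun A : E →L[ℝ] ℝ ↦ A w)
    (hderiv.unique ((hasDerivAt_const s 0).congr_of_eventuallyEq hzero))

theorem norm_mfderiv_eq_of_eventually_grad_eq_zero {x : ℝ → M} (hx : MDiffAt x s)
    (hf : ContMDiffAt (I.prod 𝓘(ℝ, ℝ)) 𝓘(ℝ, ℝ) 2 f (x s, s))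
    (hcrit : ∀ᶠ t in 𝓝 s, grad I f (x t) t = 0) (hinv : (hess I f (x s) s).IsInvertible) :
    ‖mfderiv 𝓘(ℝ, ℝ) I x s (1 : ℝ)‖ = ‖(hess I f (x s) s).inverse (partialGrad I f (x s) s)‖ := by
  rw [eq_neg_of_add_eq_zero_right (hess_mfderiv_add_partialGrad_eq_zero hx hf hcrit), map_neg,
    hinv.inverse_apply_self, norm_neg]

theorem isInvertible_fderiv_chartFDeriv_comp_inr
    (hf : ContMDiffAt (I.prod 𝓘(ℝ, ℝ)) 𝓘(ℝ, ℝ) 2 f (z, s)) (hz : grad I f z s = 0)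
    (hinj : Function.Injective (hess I f z s)) :
    (fderiv ℝ (chartFDeriv I f z) (s, extChartAt I z z) ∘L
      ContinuousLinearMap.inr ℝ ℝ E).IsInvertible := by
  refine isInvertible_of_injective_dual fun v v' hvv' ↦ hinj (ext_inner_right ℝ fun w ↦ ?_)
  exact (inner_hess_of_grad_eq_zero hf hz v w).trans
    ((congrArg (fun A : E →L[ℝ] ℝ ↦ A w) hvv').trans (inner_hess_of_grad_eq_zero hf hz v' w).symm)

theorem exists_contMDiffAt_eventually_grad_eq_zero_iff
    (hf : ContMDiffAt (I.prod 𝓘(ℝ, ℝ)) 𝓘(ℝ, ℝ) 2 f (z, s)) (hz : grad I f z s = 0)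
    (hinj : Function.Injective (hess I f z s)) :
    ∃ γ : ℝ → M, γ s = z ∧ ContMDiffAt 𝓘(ℝ, ℝ) I 1 γ s ∧
      ∀ᶠ p : M × ℝ in 𝓝 (z, s), grad I f p.1 p.2 = 0 ↔ p.1 = γ p.2 := by
  have : CompleteSpace E := FiniteDimensional.complete ℝ E
  have hiff := eventually_grad_eq_zero_iff (hf.of_le one_le_two)
  obtain ⟨γ, hγs, hγ, huniq⟩ := exists_contMDiffAt_eventually_apply_extChartAt_eq_iff
    (contDiffAt_chartFDeriv hf (mem_extChartAt_source z) one_add_one_eq_two.le) one_ne_zero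
    (isInvertible_fderiv_chartFDeriv_comp_inr hf hz hinj)
  refine ⟨γ, hγs, hγ, ?_⟩
  filter_upwards [hiff, huniq] with p hp hpγ
  rw [hp, ← hpγ, hiff.self_of_nhds.1 hz]

end Hessian

section CriticalCurve

open Filter

variable {E : Type*} [NormedAddCommGroup E] [NormedSpace ℝ E] [FiniteDimensional ℝ E]
  {H : Type*} [TopologicalSpace H] {I : ModelWithCorners ℝ E H}

section Topological

variable {M : Type*} [TopologicalSpace M] [ChartedSpace H M] [IsManifold I 2 M]
  [RiemannianBundle (fun x : M ↦ TangentSpace I x)]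
  {f : M × ℝ → ℝ} {U : Set M} {K : Set ℝ} {L : ℝ} {x : ℝ → M} {z : M} {s : ℝ}

variable (I) in
/-- The curve `x` is `C^1` at `s`, it consists of critical points near `s`, and `x s ∈ U`. This is
the notion of solution at a time to which `HasUniqueContinuationOn` is applied. -/
structure IsCriticalCurveAt (f : M × ℝ → ℝ) (U : Set M) (x : ℝ → M) (s : ℝ) : Prop where
  contMDiffAt : ContMDiffAt 𝓘(ℝ, ℝ) I 1 x s
  grad_eq_zero : ∀ᶠ t in 𝓝 s, grad I f (x t) t = 0
  mem : x s ∈ U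

variable [IsContMDiffRiemannianBundle I 1 E (fun x : M ↦ TangentSpace I x)]

variable (I) in
/-- The family `f` is `C^2` on `U × K`, and at its critical points there the Hessian is invertible
and the velocity prescribed by the Davidenko equation is smaller than `L`. -/
structure IsNondegenerateOn (f : M × ℝ → ℝ) (U : Set M) (K : Set ℝ) (L : ℝ) : Prop where
  contMDiffAt : ∀ z ∈ U, ∀ s ∈ K, ContMDiffAt (I.prod 𝓘(ℝ, ℝ)) 𝓘(ℝ, ℝ) 2 f (z, s)
  isInvertible : ∀ z ∈ U, ∀ s ∈ K, grad I f z s = 0 → (hess I f z s).IsInvertible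
  norm_lt : ∀ z ∈ U, ∀ s ∈ K, grad I f z s = 0 →
    ‖(hess I f z s).inverse (partialGrad I f z s)‖ < L

theorem IsNondegenerateOn.mono {K' : Set ℝ} (hf : IsNondegenerateOn I f U K L) (h : K' ⊆ K) :
    IsNondegenerateOn I f U K' L where
  contMDiffAt z hz s hs := hf.contMDiffAt z hz s (h hs)
  isInvertible z hz s hs := hf.isInvertible z hz s (h hs)
  norm_lt z hz s hs := hf.norm_lt z hz s (h hs)

variable [I.Boundaryless]

namespace IsCriticalCurveAt

theorem hess_mfderiv_add_partialGrad_eq_zero (hx : IsCriticalCurveAt I f U x s)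
    (hf : ContMDiffAt (I.prod 𝓘(ℝ, ℝ)) 𝓘(ℝ, ℝ) 2 f (x s, s)) :
    hess I f (x s) s (mfderiv 𝓘(ℝ, ℝ) I x s (1 : ℝ)) + partialGrad I f (x s) s = 0 :=
  RiemannianContinuation.hess_mfderiv_add_partialGrad_eq_zero
    (hx.contMDiffAt.mdifferentiableAt one_ne_zero) hf hx.grad_eq_zero

theorem norm_mfderiv_lt (hx : IsCriticalCurveAt I f U x s) (hf : IsNondegenerateOn I f U K L)
    (hs : s ∈ K) : ‖mfderiv 𝓘(ℝ, ℝ) I x s (1 : ℝ)‖ < L := by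
  have hzero := hx.grad_eq_zero.self_of_nhds
  rw [norm_mfderiv_eq_of_eventually_grad_eq_zero (hx.contMDiffAt.mdifferentiableAt one_ne_zero)
    (hf.contMDiffAt _ hx.mem s hs) hx.grad_eq_zero (hf.isInvertible _ hx.mem s hs hzero)]
  exact hf.norm_lt _ hx.mem s hs hzero

end IsCriticalCurveAt

namespace IsNondegenerateOn

theorem exists_isCriticalCurveAt (hf : IsNondegenerateOn I f U K L) (hz : z ∈ U) (hs : s ∈ K)
    (hzero : grad I f z s = 0) :
    ∃ γ : ℝ → M, γ s = z ∧ IsCriticalCurveAt I f U γ s ∧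
      ∀ᶠ p : M × ℝ in 𝓝 (z, s), grad I f p.1 p.2 = 0 → p.1 = γ p.2 := by
  obtain ⟨γ, rfl, hγ, hiff⟩ := exists_contMDiffAt_eventually_grad_eq_zero_iff
    (hf.contMDiffAt z hz s hs) hzero (hf.isInvertible z hz s hs hzero).injective
  refine ⟨γ, rfl, ⟨hγ, ?_, hz⟩, hiff.mono fun _ ↦ Iff.mp⟩
  filter_upwards [(hγ.continuousAt.prodMk continuousAt_id).eventually hiff] with t ht
  exact ht.2 rfl

theorem hasUniqueContinuationOn (hf : IsNondegenerateOn I f U K L) (hU : IsOpen U) :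
    HasUniqueContinuationOn (IsCriticalCurveAt I f U) K where
  congr {x y s} hx h :=
    { contMDiffAt := hx.contMDiffAt.congr_of_eventuallyEq h
      grad_eq_zero := by
        filter_upwards [hx.grad_eq_zero, h] with t ht hyx
        rwa [hyx]
      mem := h.self_of_nhds ▸ hx.mem }
  eventually {x s} hx := by
    filter_upwards [(contMDiffAt_iff_contMDiffAt_nhds (by decide)).1 hx.contMDiffAt,
      hx.grad_eq_zero.eventually_nhds,
      hx.contMDiffAt.continuousAt.eventually (hU.mem_nhds hx.mem)] with t hsmooth hzero hmem
    exact ⟨hsmooth, hzero, hmem⟩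
  continuousAt hx := hx.contMDiffAt.continuousAt
  eventuallyEq {x y s} hs hx hy hxy := by
    obtain ⟨γ, -, -, huniq⟩ :=
      hf.exists_isCriticalCurveAt hx.mem hs hx.grad_eq_zero.self_of_nhds
    have hγ {c : ℝ → M} (hc : IsCriticalCurveAt I f U c s) (hcs : c s = x s) : c =ᶠ[𝓝 s] γ := by
      rw [← hcs] at huniq
      filter_upwards [hc.grad_eq_zero, (hc.contMDiffAt.continuousAt.prodMk
        continuousAt_id).eventually huniq] with t ht hct using hct ht
    exact (hγ hx rfl).trans (hγ hy hxy.symm).symm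

end IsNondegenerateOn

end Topological

variable [I.Boundaryless]
  {M : Type*} [EMetricSpace M] [CompleteSpace M] [ChartedSpace H M] [IsManifold I 2 M]
  [RiemannianBundle (fun x : M ↦ TangentSpace I x)]
  [IsContMDiffRiemannianBundle I 1 E (fun x : M ↦ TangentSpace I x)] [IsRiemannianManifold I M]
  {f : M × ℝ → ℝ} {U : Set M} {a b L : ℝ} {x : ℝ → M} {x₀ : M}

namespace IsNondegenerateOn

theorem exists_isCriticalCurveAt_right_endpoint (hf : IsNondegenerateOn I f U (Icc a b) L)
    (hball : {z : M | edist (x a) z < ENNReal.ofReal (L * (b - a))} ⊆ U) (hab : a < b)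
    (hx : ∀ s ∈ Ico a b, IsCriticalCurveAt I f U x s) :
    ∃ γ : ℝ → M, IsCriticalCurveAt I f U γ b ∧ x =ᶠ[𝓝[<] b] γ := by
  obtain ⟨z, hz, hxz⟩ := exists_tendsto_nhdsLT_of_edist_lt hab fun s hs t ht hst ↦
    edist_lt_of_norm_mfderiv_lt (I := I) hst
      (fun r hr ↦ (hx r ⟨hs.1.trans hr.1, hr.2.trans_lt ht.2⟩).contMDiffAt.contMDiffWithinAt)
      fun r hr ↦ (hx r ⟨hs.1.trans hr.1.le, hr.2.trans ht.2⟩).norm_mfderiv_lt hf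
        ⟨hs.1.trans hr.1.le, hr.2.le.trans ht.2.le⟩
  have hzU : z ∈ U := hball hxz
  have hb : b ∈ Icc a b := ⟨hab.le, le_rfl⟩
  have hgraph : Tendsto (fun t ↦ (x t, t)) (𝓝[<] b) (𝓝 (z, b)) :=
    hz.prodMk_nhds (tendsto_id.mono_right nhdsWithin_le_nhds)
  have hcrit : ∀ᶠ t in 𝓝[<] b, grad I f (x t) t = 0 := by
    filter_upwards [Ico_mem_nhdsLT hab] with t ht using (hx t ht).grad_eq_zero.self_of_nhds
  have hzero : grad I f z b = 0 := grad_eq_zero_of_frequently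
    ((hf.contMDiffAt z hzU b hb).of_le one_le_two) (hgraph.frequently hcrit.frequently)
  obtain ⟨γ, -, hγ, huniq⟩ := hf.exists_isCriticalCurveAt hzU hb hzero
  exact ⟨γ, hγ, by filter_upwards [hcrit, hgraph.eventually huniq] with t ht hxt using hxt ht⟩

theorem exists_isCriticalCurveAt_Icc (hf : IsNondegenerateOn I f U (Icc a b) L) (hU : IsOpen U)
    (hball : {z : M | edist x₀ z < ENNReal.ofReal (L * (b - a))} ⊆ U) (hab : a ≤ b)
    (hx₀ : x₀ ∈ U) (hzero : grad I f x₀ a = 0) :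
    ∃ x : ℝ → M, x a = x₀ ∧ ∀ s ∈ Icc a b, IsCriticalCurveAt I f U x s := by
  have ha : a ∈ Icc a b := ⟨le_rfl, hab⟩
  have hL : 0 ≤ L := (norm_nonneg _).trans (hf.norm_lt x₀ hx₀ a ha hzero).le
  refine (hf.hasUniqueContinuationOn hU).exists_forall_Icc hab ?_ ?_
  · obtain ⟨γ, hγa, hγ, -⟩ := hf.exists_isCriticalCurveAt hx₀ ha hzero
    exact ⟨γ, hγa, hγ⟩
  · rintro T ⟨haT, hTb⟩ x rfl hx
    have hle : ENNReal.ofReal (L * (T - a)) ≤ ENNReal.ofReal (L * (b - a)) := by gcongr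
    exact (hf.mono (Icc_subset_Icc_right hTb)).exists_isCriticalCurveAt_right_endpoint
      (fun z hz ↦ hball (lt_of_lt_of_le (b := ENNReal.ofReal (L * (T - a))) hz hle)) haT hx

end IsNondegenerateOn

end CriticalCurve

end RiemannianContinuation

end

theorem theorem3p1_general {E : Type*} [NormedAddCommGroup E] [NormedSpace ℝ E]
    [FiniteDimensional ℝ E] {H : Type*} [TopologicalSpace H] {I : ModelWithCorners ℝ E H}
    [I.Boundaryless] {M : Type*} [EMetricSpace M] [ChartedSpace H M] [IsManifold I 2 M]
    [RiemannianBundle (fun x : M ↦ TangentSpace I x)]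
    [IsContMDiffRiemannianBundle I 1 E (fun x : M ↦ TangentSpace I x)]
    [IsRiemannianManifold I M] [CompleteSpace M]
    {U : Set M} (hU : IsOpen U) {f : M × ℝ → ℝ} {a b L : ℝ} (hab : a ≤ b)
    (hf : RiemannianContinuation.IsNondegenerateOn I f U (Icc a b) L)
    {x₀ : M} (hx₀ : x₀ ∈ U) (hcrit : RiemannianContinuation.grad I f x₀ a = 0)
    (hball : {x : M | edist x₀ x < ENNReal.ofReal (L * (b - a))} ⊆ U) :
    ∃ (J : Set ℝ) (x : ℝ → M), IsOpen J ∧ J.OrdConnected ∧ Icc a b ⊆ J ∧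
      ContMDiffOn 𝓘(ℝ, ℝ) I 1 x J ∧ x a = x₀ ∧
      ∀ s ∈ Icc a b, x s ∈ U ∧ RiemannianContinuation.grad I f (x s) s = 0 ∧
        RiemannianContinuation.hess I f (x s) s (mfderiv 𝓘(ℝ, ℝ) I x s (1 : ℝ)) +
          RiemannianContinuation.partialGrad I f (x s) s = 0 := by
  obtain ⟨x, hxa, hx⟩ := hf.exists_isCriticalCurveAt_Icc hU hball hab hx₀ hcrit
  have hopen : IsOpen {s | RiemannianContinuation.IsCriticalCurveAt I f U x s} :=
    isOpen_iff_eventually.2 fun _ ↦ (hf.hasUniqueContinuationOn hU).eventually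
  obtain ⟨δ, hδ, hJ⟩ := isCompact_Icc.exists_thickening_subset_open hopen hx
  refine ⟨Metric.thickening δ (Icc a b), x, Metric.isOpen_thickening,
    ((convex_Icc a b).thickening δ).ordConnected, Metric.self_subset_thickening hδ _,
    fun s hs ↦ (hJ hs).contMDiffAt.contMDiffWithinAt, hxa, fun s hs ↦ ?_⟩
  exact ⟨(hx s hs).mem, (hx s hs).grad_eq_zero.self_of_nhds,
    (hx s hs).hess_mfderiv_add_partialGrad_eq_zero (hf.contMDiffAt _ (hx s hs).mem s hs)⟩

theorem theorem3p1 {E : Type*} [NormedAddCommGroup E] [NormedSpace ℝ E] [FiniteDimensional ℝ E]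
    {d : ℕ} (hd : Module.finrank ℝ E = d)
    {M : Type*} [EMetricSpace M] [ChartedSpace E M]
    [IsManifold 𝓘(ℝ, E) ∞ M]
    [RiemannianBundle (fun x : M ↦ TangentSpace 𝓘(ℝ, E) x)]
    [IsContMDiffRiemannianBundle 𝓘(ℝ, E) ∞ E (fun x : M ↦ TangentSpace 𝓘(ℝ, E) x)]
    [IsRiemannianManifold 𝓘(ℝ, E) M] [CompleteSpace M]
    (U : Set M) (hU : IsOpen U) (V : Set (M × ℝ)) (hV : IsOpen V)
    (hUV : U ×ˢ Icc (0 : ℝ) 1 ⊆ V)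
    (f : M × ℝ → ℝ) (hf : ContMDiffOn (𝓘(ℝ, E).prod 𝓘(ℝ, ℝ)) 𝓘(ℝ, ℝ) 2 f V)
    (x₀ : M) (hx₀ : x₀ ∈ U) (hcrit : RiemannianContinuation.grad 𝓘(ℝ, E) f x₀ 0 = 0)
    (L : ℝ) (hL : 0 < L) (hball : {x : M | edist x₀ x < ENNReal.ofReal L} ⊆ U)
    (hrank : ∀ z ∈ U, ∀ lam ∈ Icc (0 : ℝ) 1,
      Module.finrank ℝ (RiemannianContinuation.hess 𝓘(ℝ, E) f z lam).range = d)
    (hbound : ∀ z ∈ U, ∀ lam ∈ Icc (0 : ℝ) 1,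
      ‖(RiemannianContinuation.hess 𝓘(ℝ, E) f z lam).inverse
        (RiemannianContinuation.partialGrad 𝓘(ℝ, E) f z lam)‖ < L) :
    ∃ (J : Set ℝ) (x : ℝ → M), IsOpen J ∧ J.OrdConnected ∧ Icc (0 : ℝ) 1 ⊆ J ∧
      ContMDiffOn 𝓘(ℝ, ℝ) 𝓘(ℝ, E) 1 x J ∧
      x 0 = x₀ ∧
      (∀ lam ∈ Icc (0 : ℝ) 1,
        x lam ∈ U ∧
        RiemannianContinuation.grad 𝓘(ℝ, E) f (x lam) lam = 0 ∧
        RiemannianContinuation.hess 𝓘(ℝ, E) f (x lam) lam (mfderiv 𝓘(ℝ, ℝ) 𝓘(ℝ, E) x lam (1 : ℝ))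
          + RiemannianContinuation.partialGrad 𝓘(ℝ, E) f (x lam) lam = 0) := by
  have (z : M) : FiniteDimensional ℝ (TangentSpace 𝓘(ℝ, E) z) :=
    inferInstanceAs (FiniteDimensional ℝ E)
  have hdeg : RiemannianContinuation.IsNondegenerateOn 𝓘(ℝ, E) f U (Icc 0 1) L :=
    { contMDiffAt := fun z hz s hs ↦ hf.contMDiffAt (hV.mem_nhds (hUV ⟨hz, hs⟩))
      isInvertible := fun z hz s hs _ ↦
        RiemannianContinuation.isInvertible_of_finrank_range_eq ((hrank z hz s hs).trans hd.symm)
      norm_lt := fun z hz s hs _ ↦ hbound z hz s hs }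
  exact theorem3p1_general hU zero_le_one hdeg hx₀ hcrit (by simpa using hball)
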